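/- Let $2\le k\le n-1$ and let $\mathbb{D}^n$ be the open unit polydisc in $\mathbb{C}^n$. Let $\mathcal{V}\subset\mathbb{D}^n$ be algebraic, i.e. $\mathcal{V}=\mathbb{D}^n\cap\bigcap_{j=1}^s p_j^{-1}(0)$ for some polynomials $p_1,\dots,p_s$, and one-dimensional. Suppose that $\mathcal{V}$ has the polynomial extension property with respect to $\mathbb{D}^n$: for every polynomial $p$ there is a bounded holomorphic function $F$ on $\mathbb{D}^n$ with $F|_{\mathcal{V}}=p|_{\mathcal{V}}$ and $\sup_{\mathbb{D}^n}|F|=\sup_{\mathcal{V}}|p|$. Suppose that $\mathcal{V}$ contains $0$ and a point $w=(w_1,\dots,w_1,w_{k+1},\dots,w_n)$ (the first $k$ coordinates are equal) which is a regular point of $\mathcal{V}$ (near $w$ the set $\mathcal{V}$ is a complex submanifold) and satisfies $|w_1|>|w_j|$ for $j=k+1,\dots,n$. Then the irreducible component $S\subset\mathcal{V}$ passing through $w$ (the closure in $\mathcal{V}$ of the connected component containing $w$ of the set of regular points of $\mathcal{V}$) is contained in $\{z\in\mathbb{C}^n : z_1=z_2=\dots=z_k\}$. -/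

import Mathlib

/-- The open unit polydisc `𝔻ⁿ` in `ℂⁿ`. -/
def polydisc (n : ℕ) : Set (Fin n → ℂ) := {z | ∀ i, ‖z i‖ < 1}

/-- `V` is algebraic in `𝔻ⁿ`: the common zero set in `𝔻ⁿ` of finitely many polynomials. -/
def IsAlgebraicIn {n : ℕ} (V : Set (Fin n → ℂ)) : Prop :=
  ∃ P : Finset (MvPolynomial (Fin n) ℂ),
    V = {z | z ∈ polydisc n ∧ ∀ p ∈ P, MvPolynomial.eval z p = 0}

/-- The dimension of an algebraic set: the Krull dimension of its coordinate ring
`ℂ[z₁, …, zₙ] / I(V)`, where `I(V)` is the ideal of the polynomials vanishing on `V`.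
(This quotient is the ring of the restrictions of polynomials to `V`.) -/
noncomputable def algDim {n : ℕ} (V : Set (Fin n → ℂ)) : WithBot ℕ∞ :=
  ringKrullDim (MvPolynomial (Fin n) ℂ ⧸ MvPolynomial.vanishingIdeal ℂ V)

/-- The polynomial extension property of `V` with respect to `U`: every polynomial that is bounded
on `V` agrees on `V` with a bounded holomorphic function on `U` having the same supremum norm. -/
def PolynomialExtensionProperty {n : ℕ} (U V : Set (Fin n → ℂ)) : Prop :=
  ∀ p : MvPolynomial (Fin n) ℂ,
    BddAbove (Set.range fun z : V => ‖MvPolynomial.eval z.1 p‖) →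
    ∃ F : (Fin n → ℂ) → ℂ,
      DifferentiableOn ℂ F U ∧
      BddAbove (Set.range fun z : U => ‖F z.1‖) ∧
      (∀ z ∈ V, F z = MvPolynomial.eval z p) ∧
      (⨆ z : U, ‖F z.1‖) = ⨆ z : V, ‖MvPolynomial.eval z.1 p‖

/-- `a` is a regular point of `V`: near `a`, the set `V` is a complex submanifold (of some
dimension `d`), i.e. a biholomorphic change of coordinates carries `V` near `a` onto a piece of
the coordinate subspace on which the coordinates after the `d`-th vanish. -/
def IsRegularPoint {n : ℕ} (V : Set (Fin n → ℂ)) (a : Fin n → ℂ) : Prop :=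
  a ∈ V ∧ ∃ d : ℕ, d ≤ n ∧ ∃ Φ : OpenPartialHomeomorph (Fin n → ℂ) (Fin n → ℂ),
    a ∈ Φ.source ∧ DifferentiableOn ℂ Φ Φ.source ∧ DifferentiableOn ℂ Φ.symm Φ.target ∧
    ∀ z ∈ Φ.source, z ∈ V ↔ ∀ i : Fin n, d ≤ i.val → Φ z i = 0

/-- The irreducible components of an analytic set `V` (closed in some open set): the closures in
`V` of the connected components of the set of regular points of `V`. -/
def IsIrreducibleComponent {n : ℕ} (V S : Set (Fin n → ℂ)) : Prop :=
  ∃ a, IsRegularPoint V a ∧ S = closure (connectedComponentIn {z | IsRegularPoint V z} a) ∩ V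

/-! Suppose that an analytic curve in `V` through `w` leaves the diagonal subspace, and let `v` be
the leading coefficient of its deviation. If a polynomial bounded by 1 on `V` vanishes at 0 and
equals `w i₀` at `w`, the Schwarz lemma bounds its extension `F` by the sup norm, with equality of
moduli at `w`. Such an extremal `F` equals the `i₀`-th coordinate on the diagonal near `w`
(`eventually_apply_collapse_eq`), and its derivative at `w` sends `v` into the convex hull of the
dominant `v l` (`re_mul_fderiv_le`).

The mean of two coordinates `z i`, `z j` prescribes the midpoint of `v i` and `v j`, which can be
taken on an edge of the hull. Its modulus is at most 1 minus a multiple of `‖z i - z j‖ ^ 2`.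
Dimension one leaves room for a small multiple of `(z i - z j) * σ(z i)`
(`exists_perturbation_norm_le_one`), which pushes the prescribed value out of the hull: a
contradiction. Hence `V` lies in the diagonal near `w`, and the identity theorem carries this along
the component. -/

/-! ### Commutative algebra: the consequence of dimension one -/

theorem MvPolynomial.eval_polynomial_aeval {σ : Type*} (z : σ → ℂ) (u : MvPolynomial σ ℂ)
    (χ : Polynomial ℂ) :
    MvPolynomial.eval z (Polynomial.aeval u χ) = χ.eval (MvPolynomial.eval z u) := by
  rw [Polynomial.aeval_def, Polynomial.hom_eval₂, Polynomial.eval_eq_sum, Polynomial.eval₂_eq_sum]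
  simp [MvPolynomial.algebraMap_eq]

/-- On a set of dimension at most one, any polynomial `u` satisfies, away from the zero set of `h`,
an algebraic equation modulo `h`. -/
theorem exists_aeval_eq_mul_add_of_algDim_le_one {n : ℕ} {V : Set (Fin n → ℂ)}
    (hdim : algDim V ≤ 1) (u h : MvPolynomial (Fin n) ℂ) :
    ∃ χ : Polynomial ℂ, χ ≠ 0 ∧ ∃ b : MvPolynomial (Fin n) ℂ, ∀ z ∈ V,
      χ.eval (MvPolynomial.eval z u) * MvPolynomial.eval z h =
        MvPolynomial.eval z h ^ 2 * MvPolynomial.eval z b := by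
  set I := MvPolynomial.vanishingIdeal ℂ V with hI
  have memI : ∀ p, p ∈ I ↔ ∀ z ∈ V, MvPolynomial.eval z p = 0 := fun p ↦ by
    rw [hI, MvPolynomial.mem_vanishingIdeal_iff]
    simp [MvPolynomial.aeval_eq_eval]
  -- The colon ideal `(I : h)`. Modulo `J`, `h` is a non-zero-divisor: if `p * h ^ 2` vanishes on
  -- `V`, so does `p * h`.
  let J : Ideal (MvPolynomial (Fin n) ℂ) := Submodule.comap (LinearMap.mulRight _ h) I
  have memJ : ∀ p, p ∈ J ↔ ∀ z ∈ V, MvPolynomial.eval z p * MvPolynomial.eval z h = 0 := fun p ↦ by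
    change p * h ∈ I ↔ _
    simp [memI]
  have hIJ : I ≤ J := fun p hp ↦ (memJ p).2 fun z hz ↦ by rw [(memI p).1 hp z hz, zero_mul]
  let B := MvPolynomial (Fin n) ℂ ⧸ J
  let hB : B := Ideal.Quotient.mk J h
  have hreg : hB ∈ nonZeroDivisors B := by
    rw [mem_nonZeroDivisors_iff_right]
    intro x hx
    obtain ⟨p, rfl⟩ := Ideal.Quotient.mk_surjective x
    rw [← map_mul, Ideal.Quotient.eq_zero_iff_mem, memJ] at hx
    rw [Ideal.Quotient.eq_zero_iff_mem, memJ]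
    intro z hz
    have := hx z hz
    simpa using this
  have hBdim : ringKrullDim B ≤ 1 := le_trans
    (ringKrullDim_le_of_surjective (Ideal.Quotient.factor hIJ) (Ideal.Quotient.factor_surjective hIJ))
    hdim
  let D := B ⧸ Ideal.span {hB}
  -- Dividing by a non-zero-divisor lowers the dimension, so `D` is finite over `ℂ` and `u` is
  -- integral in it. If `D` is zero, its dimension is `⊥` and the bound still holds.
  have hDdim : ringKrullDim D ≤ 0 := by
    have h1 : ringKrullDim D + 1 ≤ 0 + 1 := by
      simpa using (ringKrullDim_quotient_succ_le_of_nonZeroDivisor hreg).trans hBdim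
    exact ENat.WithBot.add_le_add_one_right_iff.1 h1
  have : Ring.KrullDimLE 0 D := Ring.krullDimLE_iff.mpr hDdim
  have : Module.Finite ℂ D := (Module.finite_iff_krullDimLE_zero ℂ D).2 this
  have : Algebra.IsIntegral ℂ D := Algebra.IsIntegral.of_finite ℂ D
  let uD : D := Ideal.Quotient.mk _ (Ideal.Quotient.mk J u)
  obtain ⟨χ, hχm, hχ⟩ := ‹Algebra.IsIntegral ℂ D›.isIntegral uD
  refine ⟨χ, hχm.ne_zero, ?_⟩
  have hχ' : Ideal.Quotient.mk (Ideal.span {hB}) (Ideal.Quotient.mk J (Polynomial.aeval u χ)) = 0 := by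
    have e : (((Ideal.Quotient.mkₐ ℂ (Ideal.span {hB})).comp (Ideal.Quotient.mkₐ ℂ J))
        (Polynomial.aeval u χ)) = 0 := by
      rw [← Polynomial.aeval_algHom_apply]
      exact hχ
    exact e
  rw [Ideal.Quotient.eq_zero_iff_mem, Ideal.mem_span_singleton] at hχ'
  obtain ⟨bB, hb⟩ := hχ'
  obtain ⟨b, rfl⟩ := Ideal.Quotient.mk_surjective bB
  rw [← map_mul, Ideal.Quotient.mk_eq_mk_iff_sub_mem, memJ] at hb
  refine ⟨b, fun z hz ↦ ?_⟩
  have h1 := hb z hz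
  rw [map_sub, map_mul, MvPolynomial.eval_polynomial_aeval] at h1
  linear_combination h1

open Filter Topology Metric Set Asymptotics

/-! ### Strict differentiability from Cauchy estimates -/

/-- A bounded holomorphic map on a ball of a complex normed space is strictly differentiable at
the centre. -/
theorem DifferentiableOn.hasStrictFDerivAt_of_bounded_ball {E F : Type*}
    [NormedAddCommGroup E] [NormedSpace ℂ E] [NormedAddCommGroup F] [NormedSpace ℂ F]
    {f : E → F} {c : E} {R M : ℝ} (hR : 0 < R) (hd : DifferentiableOn ℂ f (ball c R))
    (hM : ∀ z ∈ ball c R, ‖f z‖ ≤ M) : HasStrictFDerivAt f (fderiv ℂ f c) c := by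
  have hda : ∀ z ∈ ball c R, DifferentiableAt ℂ f z := fun z hz ↦
    hd.differentiableAt (isOpen_ball.mem_nhds hz)
  have hbound : ∀ z ∈ ball c (R / 2), ‖fderiv ℂ f z‖ ≤ 2 * M / (R / 2) := by
    intro z hz
    have hsub : ball z (R / 2) ⊆ ball c R := ball_subset_ball' (by
      have := mem_ball.1 hz
      linarith)
    refine Complex.norm_fderiv_le_div_of_mapsTo_ball (hd.mono hsub) ?_ (by positivity)
    intro y hy
    rw [mem_closedBall, dist_eq_norm]
    refine (norm_sub_le _ _).trans ?_
    have h1 := hM y (hsub hy)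
    have h2 := hM z (hsub (mem_ball_self (by positivity)))
    linarith
  set K := 2 * M / (R / 2) with hK
  have hlip : ∀ x ∈ ball c (R / 2), ∀ y ∈ ball c (R / 2), ‖f y - f x‖ ≤ K * ‖y - x‖ := by
    intro x hx y hy
    exact (convex_ball c (R / 2)).norm_image_sub_le_of_norm_fderiv_le
      (fun z hz ↦ hda z (ball_subset_ball (by linarith) hz)) hbound hx hy
  refine hasStrictFDerivAt_of_hasFDerivAt_of_continuousAt (f' := fderiv ℂ f) ?_ ?_
  · filter_upwards [isOpen_ball.mem_nhds (mem_ball_self hR)] with z hz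
    exact (hda z hz).hasFDerivAt
  · have key : ∀ y ∈ ball c (R / 4), ‖fderiv ℂ f y - fderiv ℂ f c‖ ≤
        2 * (K * ‖y - c‖) / (R / 4) := by
      intro y hy
      rw [mem_ball, dist_eq_norm] at hy
      have hmem : ∀ z ∈ ball c (R / 4), z + (y - c) ∈ ball c (R / 2) := fun z hz ↦ by
        rw [mem_ball, dist_eq_norm] at hz ⊢
        calc ‖z + (y - c) - c‖ = ‖(z - c) + (y - c)‖ := by congr 1; abel
          _ ≤ ‖z - c‖ + ‖y - c‖ := norm_add_le _ _
          _ < R / 2 := by linarith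
      have hbig : ball c (R / 2) ⊆ ball c R := ball_subset_ball (by linarith)
      have hbig' : ball c (R / 4) ⊆ ball c (R / 2) := ball_subset_ball (by linarith)
      -- The Cauchy estimate for this difference, of size at most `K * ‖y - c‖`, bounds the
      -- variation of the derivative without second derivatives.
      let G : E → F := fun z ↦ f (z + (y - c)) - f z
      have hcR : c ∈ ball c (R / 4) := mem_ball_self (by positivity)
      have hG : ∀ z ∈ ball c (R / 4), HasFDerivAt G
          (fderiv ℂ f (z + (y - c)) - fderiv ℂ f z) z := by
        intro z hz
        have h1 := (hda _ (hbig (hmem z hz))).hasFDerivAt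
        have h2 := (hda _ (hbig (hbig' hz))).hasFDerivAt
        have h3 := h1.comp z ((hasFDerivAt_id z).add_const (y - c))
        exact h3.sub h2
      have hGn : ∀ z ∈ ball c (R / 4), ‖G z‖ ≤ K * ‖y - c‖ := by
        intro z hz
        simpa using hlip z (hbig' hz) _ (hmem z hz)
      have h3 : ‖fderiv ℂ G c‖ ≤ 2 * (K * ‖y - c‖) / (R / 4) := by
        refine Complex.norm_fderiv_le_div_of_mapsTo_ball
          (fun z hz ↦ (hG z hz).differentiableAt.differentiableWithinAt) ?_ (by positivity)
        intro z hz
        rw [mem_closedBall, dist_eq_norm]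
        refine (norm_sub_le _ _).trans ?_
        have := hGn z hz
        have := hGn c hcR
        linarith
      rw [(hG c hcR).fderiv] at h3
      simpa using h3
    rw [ContinuousAt, tendsto_iff_norm_sub_tendsto_zero]
    have hlim : Tendsto (fun y ↦ 2 * (K * ‖y - c‖) / (R / 4)) (𝓝 c) (𝓝 0) := by
      have : Continuous (fun y ↦ 2 * (K * ‖y - c‖) / (R / 4)) := by fun_prop
      simpa using this.tendsto c
    refine squeeze_zero' (Eventually.of_forall fun _ ↦ norm_nonneg _) ?_ hlim
    filter_upwards [isOpen_ball.mem_nhds (mem_ball_self (by positivity : 0 < R / 4))] with y hy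
    exact key y hy

/-! ### Extremal functions for the Schwarz lemma -/

/-- The linear projection of `ℂ^ι` replacing every coordinate in `s` by the `i₀`-th one. -/
noncomputable def collapse {ι : Type*} (s : Finset ι) [DecidableEq ι] (i₀ : ι) :
    (ι → ℂ) →L[ℂ] (ι → ℂ) :=
  ContinuousLinearMap.pi fun l ↦
    ContinuousLinearMap.proj (R := ℂ) (φ := fun _ : ι ↦ ℂ) (if l ∈ s then i₀ else l)

theorem collapse_apply {ι : Type*} [DecidableEq ι] {s : Finset ι} {i₀ : ι} (z : ι → ℂ) (l : ι) :
    collapse s i₀ z l = z (if l ∈ s then i₀ else l) := rfl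

section
variable {ι : Type*} [Fintype ι] {s : Finset ι} {F : (ι → ℂ) → ℂ} {w : ι → ℂ} {i₀ : ι}

/-- A holomorphic function bounded by the sup norm and attaining it at `w` depends, near `w`, only
on the first coordinate along the subspace where the dominant coordinates are equal. -/
theorem eventually_apply_collapse_eq [DecidableEq ι]
    (hF : ∀ᶠ z in 𝓝 w, DifferentiableAt ℂ F z) (hle : ∀ᶠ z in 𝓝 w, ‖F z‖ ≤ ‖z‖)
    (hFw : F w = w i₀) (hw_eq : ∀ l ∈ s, w l = w i₀) (hw_lt : ∀ l ∉ s, ‖w l‖ < ‖w i₀‖)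
    (hw0 : w i₀ ≠ 0) :
    ∀ᶠ z in 𝓝 w, F (collapse s i₀ z) = z i₀ := by
  have hcw : collapse s i₀ w = w := by
    ext l
    rw [collapse_apply]
    split_ifs with h
    · exact (hw_eq l h).symm
    · rfl
  have hcont : Tendsto (collapse s i₀) (𝓝 w) (𝓝 w) := by
    simpa [hcw] using (collapse s i₀).continuous.tendsto w
  have hne : ∀ᶠ z : ι → ℂ in 𝓝 w, z i₀ ≠ 0 :=
    (continuous_apply i₀).continuousAt.eventually_ne hw0
  have hlt : ∀ᶠ z : ι → ℂ in 𝓝 w, ∀ l ∉ s, ‖z l‖ < ‖z i₀‖ := by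
    rw [eventually_all]
    intro l
    by_cases h : l ∈ s
    · simp [h]
    · have : ∀ᶠ z : ι → ℂ in 𝓝 w, ‖z l‖ < ‖z i₀‖ :=
        (continuous_apply l).norm.continuousAt.eventually_lt
          (continuous_apply i₀).norm.continuousAt (hw_lt l h)
      exact this.mono fun z hz _ ↦ hz
  -- On the diagonal near `w` the sup norm is `‖z i₀‖`, so the quotient has modulus at most 1 and
  -- equals 1 at `w`; the maximum principle makes it constant.
  have hmax : IsLocalMax (norm ∘ fun z ↦ F (collapse s i₀ z) / z i₀) w := by
    filter_upwards [hne, hlt, hcont.eventually hle] with z hz0 hzl hz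
    simp only [Function.comp, hcw, hFw, div_self hw0, norm_one, norm_div]
    rw [div_le_one (norm_pos_iff.2 hz0)]
    refine hz.trans ((pi_norm_le_iff_of_nonneg (norm_nonneg _)).2 fun l ↦ ?_)
    rw [collapse_apply]
    split_ifs with h
    · exact le_rfl
    · exact (hzl l h).le
  have hdiff : ∀ᶠ z in 𝓝 w, DifferentiableAt ℂ (fun z ↦ F (collapse s i₀ z) / z i₀) z := by
    filter_upwards [hne, hcont.eventually hF] with z hz0 hz
    have h1 : DifferentiableAt ℂ (fun z : ι → ℂ ↦ z i₀) z := differentiableAt_apply i₀ z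
    have h2 : DifferentiableAt ℂ (fun z ↦ F (collapse s i₀ z)) z :=
      hz.comp z (collapse s i₀).differentiableAt
    simpa only [div_eq_mul_inv] using h2.fun_mul (h1.fun_inv hz0)
  filter_upwards [Complex.eventually_eq_of_isLocalMax_norm hdiff hmax, hne] with z hz hz0
  simp only [hcw, hFw, div_self hw0] at hz
  exact (div_eq_one_iff_eq hz0).1 hz

/-- The derivative at `w` of a holomorphic function bounded by the sup norm and attaining it at `w`
maps a vector into the convex hull of its dominant coordinates (tested against half-planes). -/
theorem re_mul_fderiv_le {L : (ι → ℂ) →L[ℂ] ℂ}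
    (hF : HasFDerivAt F L w) (hle : ∀ᶠ z in 𝓝 w, ‖F z‖ ≤ ‖z‖)
    (hFw : F w = w i₀) (hw_eq : ∀ l ∈ s, w l = w i₀) (hw_lt : ∀ l ∉ s, ‖w l‖ < ‖w i₀‖)
    (hw0 : w i₀ ≠ 0) (c : ℂ) (v : ι → ℂ) (M : ℝ) (hM : ∀ l ∈ s, (c * v l).re ≤ M) :
    (c * L v).re ≤ M := by
  set a := w i₀ with ha
  have ha' : (starRingEnd ℂ) a ≠ 0 := by simpa using hw0
  -- Scaled so that, along `w + t • x`, the squared modulus of a dominant coordinate is `‖a‖ ^ 2 + 2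
  -- * t * (c * v l).re + O(t ^ 2)`. The other coordinates stay smaller for small `t`.
  set x : ι → ℂ := (c / (starRingEnd ℂ) a) • v with hx
  have hxl : ∀ l, (starRingEnd ℂ) a * x l = c * v l := fun l ↦ by
    simp only [hx, Pi.smul_apply, smul_eq_mul]; field_simp
  have hLx : (starRingEnd ℂ) a * L x = c * L v := by
    simp only [hx, map_smul, smul_eq_mul]; field_simp
  let p : ℝ → ι → ℂ := fun t ↦ w + (t : ℂ) • x
  have hp : HasDerivAt p x 0 := by
    have h1 : HasDerivAt (fun t : ℝ ↦ (t : ℂ)) 1 0 := Complex.ofRealCLM.hasDerivAt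
    simpa [p] using (h1.smul_const x).const_add w
  have hp0 : p 0 = w := by simp [p]
  have hψ : HasDerivAt (fun t ↦ ((starRingEnd ℂ) a * F (p t)).re) (c * L v).re 0 := by
    have h1 : HasDerivAt (F ∘ p) (L x) 0 := by
      have h2 : HasFDerivAt F (L.restrictScalars ℝ) (p 0) := by
        rw [hp0]; exact hF.restrictScalars ℝ
      simpa using h2.comp_hasDerivAt (0 : ℝ) hp
    have h3 := h1.const_mul ((starRingEnd ℂ) a)
    rw [hLx] at h3
    exact Complex.reCLM.hasFDerivAt.comp_hasDerivAt (0 : ℝ) h3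
  have hslope := hψ.tendsto_slope_zero_right
  have hpc : Tendsto p (𝓝[>] 0) (𝓝 w) := by
    simpa [hp0] using hp.continuousAt.tendsto.mono_left nhdsWithin_le_nhds
  have hmain : ∀ᶠ t : ℝ in 𝓝[>] 0, t⁻¹ • (((starRingEnd ℂ) a * F (p (0 + t))).re -
      ((starRingEnd ℂ) a * F (p 0)).re) ≤ M + t * (‖x‖ ^ 2 / 2) := by
    have hsmall : ∀ᶠ t : ℝ in 𝓝[>] 0, ∀ l ∉ s, ‖a‖ * ‖p t l‖ ≤
        ‖a‖ ^ 2 + t * M + t ^ 2 * (‖x‖ ^ 2 / 2) := by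
      rw [eventually_all]
      intro l
      by_cases h : l ∈ s
      · simp [h]
      · have hc1 : Tendsto (fun t : ℝ ↦ ‖a‖ * ‖p t l‖) (𝓝[>] 0) (𝓝 (‖a‖ * ‖w l‖)) :=
          (((continuous_apply l).tendsto w).comp hpc).norm.const_mul _
        have hc2 : Tendsto (fun t : ℝ ↦ ‖a‖ ^ 2 + t * M + t ^ 2 * (‖x‖ ^ 2 / 2)) (𝓝[>] 0)
            (𝓝 (‖a‖ ^ 2)) := by
          have : Continuous (fun t : ℝ ↦ ‖a‖ ^ 2 + t * M + t ^ 2 * (‖x‖ ^ 2 / 2)) := by fun_prop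
          simpa using (this.tendsto 0).mono_left nhdsWithin_le_nhds
        have hlt : ‖a‖ * ‖w l‖ < ‖a‖ ^ 2 := by
          rw [sq]; exact mul_lt_mul_of_pos_left (hw_lt l h) (norm_pos_iff.2 hw0)
        exact (hc1.eventually_lt hc2 hlt).mono fun t ht _ ↦ ht.le
    filter_upwards [hsmall, hpc.eventually hle, self_mem_nhdsWithin] with t hts htF ht
    have ht : 0 < t := ht
    have hbd : ‖a‖ * ‖p t‖ ≤ ‖a‖ ^ 2 + t * M + t ^ 2 * (‖x‖ ^ 2 / 2) := by
      have hall : ∀ l, ‖a‖ * ‖p t l‖ ≤ ‖a‖ ^ 2 + t * M + t ^ 2 * (‖x‖ ^ 2 / 2) := by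
        intro l
        by_cases h : l ∈ s
        · have e1 : ‖p t l‖ ^ 2 = ‖a‖ ^ 2 + 2 * t * (c * v l).re + t ^ 2 * ‖x l‖ ^ 2 := by
            rw [← hxl l]
            simp only [p, Pi.add_apply, Pi.smul_apply, smul_eq_mul, hw_eq l h]
            rw [← Complex.normSq_eq_norm_sq, ← Complex.normSq_eq_norm_sq,
              ← Complex.normSq_eq_norm_sq]
            simp only [Complex.normSq_apply, Complex.add_re, Complex.add_im, Complex.mul_re,
              Complex.mul_im, Complex.ofReal_re, Complex.ofReal_im, Complex.conj_re,
              Complex.conj_im]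
            ring
          have e2 : ‖x l‖ ^ 2 ≤ ‖x‖ ^ 2 := by gcongr; exact norm_le_pi_norm x l
          have e3 := mul_le_mul_of_nonneg_left (hM l h) ht.le
          have e4 := mul_le_mul_of_nonneg_left e2 (sq_nonneg t)
          nlinarith [sq_nonneg (‖a‖ - ‖p t l‖)]
        · exact hts l h
      have hapos : 0 < ‖a‖ := norm_pos_iff.2 hw0
      obtain h1 : ‖p t‖ ≤ (‖a‖ ^ 2 + t * M + t ^ 2 * (‖x‖ ^ 2 / 2)) / ‖a‖ := by
        refine (pi_norm_le_iff_of_nonneg ?_).2 fun l ↦ ?_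
        · exact div_nonneg ((by positivity : 0 ≤ ‖a‖ * ‖p t i₀‖).trans (hall i₀)) hapos.le
        · rw [le_div_iff₀ hapos, mul_comm]; exact hall l
      rw [le_div_iff₀ hapos] at h1
      linarith
    have h5 : ((starRingEnd ℂ) a * F (p t)).re ≤ ‖a‖ * ‖p t‖ := by
      refine (Complex.re_le_norm _).trans ?_
      rw [norm_mul, RCLike.norm_conj]
      gcongr
    have h6 : ((starRingEnd ℂ) a * F (p 0)).re = ‖a‖ ^ 2 := by
      rw [hp0, hFw, Complex.conj_mul', ← Complex.ofReal_pow, Complex.ofReal_re]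
    rw [zero_add, h6, smul_eq_mul, inv_mul_le_iff₀ ht]
    nlinarith
  have hlim : Tendsto (fun t : ℝ ↦ M + t * (‖x‖ ^ 2 / 2)) (𝓝[>] 0) (𝓝 M) := by
    have : Continuous (fun t : ℝ ↦ M + t * (‖x‖ ^ 2 / 2)) := by fun_prop
    simpa using (this.tendsto 0).mono_left nhdsWithin_le_nhds
  exact le_of_tendsto_of_tendsto hslope hlim hmain
end

/-! ### Convex geometry in the plane -/

/-- A nonconstant finite family of complex numbers has an edge of its convex hull. -/
theorem exists_supporting_edge {ι : Type*} (s : Finset ι) (v : ι → ℂ)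
    (hv : ∃ i ∈ s, ∃ j ∈ s, v i ≠ v j) :
    ∃ i ∈ s, ∃ j ∈ s, v i ≠ v j ∧ ∃ c : ℂ, c ≠ 0 ∧ (c * v j).re = (c * v i).re ∧
      ∀ l ∈ s, (c * v l).re ≤ (c * v i).re := by
  obtain ⟨i₁, hi₁, j₁, hj₁, hne⟩ := hv
  obtain ⟨i, hi, hmax⟩ := s.exists_max_image (fun l ↦ (v l).re) ⟨i₁, hi₁⟩
  by_cases htie : ∃ j ∈ s, v i ≠ v j ∧ (v j).re = (v i).re
  · obtain ⟨j, hj, hij, hre⟩ := htie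
    exact ⟨i, hi, j, hj, hij, 1, one_ne_zero, by simpa using hre, fun l hl ↦ by simpa using hmax l hl⟩
  · push Not at htie
    classical
    obtain ⟨j₀, hj₀, hij₀⟩ : ∃ j ∈ s, v i ≠ v j := by
      by_contra! hcon
      exact hne ((hcon i₁ hi₁).symm.trans (hcon j₁ hj₁))
    have hlt : ∀ l ∈ s, v i ≠ v l → 0 < (v i).re - (v l).re := fun l hl h ↦
      sub_pos.2 (lt_of_le_of_ne (hmax l hl) (htie l hl h))
    obtain ⟨j, hj, hjmax⟩ := (s.filter fun l ↦ v i ≠ v l).exists_max_image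
      (fun l ↦ ((v l).im - (v i).im) / ((v i).re - (v l).re)) ⟨j₀, by simp [hj₀, hij₀]⟩
    rw [Finset.mem_filter] at hj
    -- Rotates the vertical supporting line about `v i` until it meets a second point; the
    -- corresponding functional is `σ * re + im`.
    set σ := ((v j).im - (v i).im) / ((v i).re - (v j).re) with hσ
    have hj' : (v j).im - (v i).im = σ * ((v i).re - (v j).re) := by
      rw [hσ, div_mul_cancel₀ _ (hlt j hj.1 hj.2).ne']
    refine ⟨i, hi, j, hj.1, hj.2, (σ : ℂ) - Complex.I, ?_, ?_, ?_⟩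
    · intro h
      simpa using congrArg Complex.im h
    · simp
      linarith
    · intro l hl
      by_cases h : v i = v l
      · rw [h]
      · have := hjmax l (by simp [hl, h])
        rw [div_le_iff₀ (hlt l hl h)] at this
        simp
        linarith

/-! ### Perturbing the mean of two coordinates -/

theorem polydisc_eq_ball (n : ℕ) : polydisc n = ball 0 1 := by
  ext z
  simp [polydisc, pi_norm_lt_iff]

theorem MvPolynomial.exists_norm_eval_le_polydisc {n : ℕ} (p : MvPolynomial (Fin n) ℂ) :
    ∃ B : ℝ, 0 ≤ B ∧ ∀ z ∈ polydisc n, ‖MvPolynomial.eval z p‖ ≤ B := by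
  obtain ⟨B, hB⟩ := (isCompact_closedBall (0 : Fin n → ℂ) 1).exists_bound_of_continuousOn
    (MvPolynomial.continuous_eval p).continuousOn
  refine ⟨B, (norm_nonneg _).trans (hB 0 (by simp)), fun z hz ↦ hB z ?_⟩
  rw [polydisc_eq_ball] at hz
  exact ball_subset_closedBall hz

/-- The parallelogram law bounds the square of the left side by `1 - ‖x - y‖ ^ 2 / 4`, and `t ≤ (1 +
t ^ 2) / 2`. This quadratic gap absorbs the perturbation. -/
theorem Complex.norm_midpoint_le_one_sub {x y : ℂ} (hx : ‖x‖ ≤ 1) (hy : ‖y‖ ≤ 1) :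
    ‖(x + y) / 2‖ ≤ 1 - ‖x - y‖ ^ 2 / 8 := by
  have h := parallelogram_law_with_norm ℝ x y
  have h2 : ‖(x + y) / 2‖ = ‖x + y‖ / 2 := by simp
  rw [h2]
  have hx2 : ‖x‖ ^ 2 ≤ 1 := pow_le_one₀ (norm_nonneg _) hx
  have hy2 : ‖y‖ ^ 2 ≤ 1 := pow_le_one₀ (norm_nonneg _) hy
  nlinarith [sq_nonneg (‖x + y‖ / 2 - 1)]

/-- On a one-dimensional algebraic subset of the polydisc, the mean of two coordinates can be
perturbed by a polynomial whose order of vanishing at a point with `z i = z j = a` is that of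
`z i - z j`, without making its norm exceed one. -/
theorem exists_perturbation_norm_le_one {n : ℕ} {V : Set (Fin n → ℂ)} (hVD : V ⊆ polydisc n)
    (hdim : algDim V ≤ 1) (i j : Fin n) {a : ℂ} (ha : ‖a‖ < 1) :
    ∃ σ : Polynomial ℂ, σ.eval a ≠ 0 ∧ ∀ κ : ℂ, ∃ ε : ℝ, 0 < ε ∧ ∀ z ∈ V,
      ‖(z i + z j) / 2 + ε * κ * (z i - z j) * σ.eval (z i)‖ ≤ 1 := by
  obtain ⟨χ, hχ, b, hb⟩ := exists_aeval_eq_mul_add_of_algDim_le_one hdim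
    (MvPolynomial.X i) (MvPolynomial.X i - MvPolynomial.X j)
  simp only [MvPolynomial.eval_X, map_sub] at hb
  obtain ⟨σ, hσ, hσa⟩ := Polynomial.exists_eq_pow_rootMultiplicity_mul_and_not_dvd χ hχ a
  set m := χ.rootMultiplicity a
  -- Removing the factor `(X - a) ^ m` from `χ` keeps the perturbation from vanishing to extra order
  -- at `a`. `σ` is fixed before `κ`, which will be normalised by `σ.eval a`.
  refine ⟨σ, fun h ↦ hσa (Polynomial.dvd_iff_isRoot.2 h), fun κ ↦ ?_⟩
  obtain ⟨B, hB0, hB⟩ := (MvPolynomial.C κ * b).exists_norm_eval_le_polydisc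
  obtain ⟨B', hB0', hB'⟩ := (MvPolynomial.C κ * (MvPolynomial.X i - MvPolynomial.X j) *
    Polynomial.aeval (MvPolynomial.X i) σ).exists_norm_eval_le_polydisc
  simp only [map_mul, MvPolynomial.eval_C, map_sub, MvPolynomial.eval_X,
    MvPolynomial.eval_polynomial_aeval] at hB hB'
  set ρ := (1 - ‖a‖) / 2 with hρ
  have hρ0 : 0 < ρ := by simp only [hρ]; linarith
  -- The first bound serves where `z i` is at least `ρ` away from `a`: there `q` is `O(‖z i - z j‖ ^
  -- 2)`. The second serves near `a`, where the mean has modulus at most `1 - ρ / 2`.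
  set ε := min (ρ ^ m / (8 * (B + 1))) (ρ / (2 * (B' + 1))) with hε
  have hε0 : 0 < ε := by positivity
  refine ⟨ε, hε0, fun z hz ↦ ?_⟩
  have hzD := hVD hz
  have hp := Complex.norm_midpoint_le_one_sub (hzD i).le (hzD j).le
  set q := κ * (z i - z j) * σ.eval (z i) with hq
  have hsplit : (z i + z j) / 2 + ε * κ * (z i - z j) * σ.eval (z i) =
      (z i + z j) / 2 + ε * q := by rw [hq]; ring
  rw [hsplit]
  refine (norm_add_le _ _).trans ?_
  rw [norm_mul, Complex.norm_real, Real.norm_of_nonneg hε0.le]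
  by_cases hfar : ρ ≤ ‖z i - a‖
  · have e1 : (z i - a) ^ m * q = (z i - z j) ^ 2 * (κ * MvPolynomial.eval z b) := by
      have := hb z hz
      rw [hσ] at this
      simp only [Polynomial.eval_mul, Polynomial.eval_pow, Polynomial.eval_sub,
        Polynomial.eval_X, Polynomial.eval_C] at this
      rw [hq]
      linear_combination κ * this
    have e2 : ‖z i - a‖ ^ m * ‖q‖ ≤ ‖z i - z j‖ ^ 2 * B := by
      rw [← norm_pow, ← norm_mul, e1, norm_mul, norm_pow]
      gcongr
      exact hB z hzD
    have e3 : ρ ^ m * ‖q‖ ≤ ‖z i - z j‖ ^ 2 * B := le_trans (by gcongr) e2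
    have e4 : ε * ‖q‖ ≤ ρ ^ m / (8 * (B + 1)) * ‖q‖ := by
      gcongr; exact min_le_left _ _
    have e5 : ρ ^ m / (8 * (B + 1)) * ‖q‖ ≤ ‖z i - z j‖ ^ 2 / 8 := by
      rw [div_mul_eq_mul_div, div_le_div_iff₀ (by positivity) (by norm_num)]
      nlinarith [sq_nonneg ‖z i - z j‖]
    linarith
  · push Not at hfar
    have e1 : ‖z i‖ ≤ 1 - ρ := by
      have := norm_sub_norm_le (z i) a
      simp only [hρ] at hfar ⊢
      linarith
    have e2 : ‖(z i + z j) / 2‖ ≤ 1 - ρ / 2 := by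
      rw [norm_div, Complex.norm_two]
      have := norm_add_le (z i) (z j)
      have := (hzD j).le
      linarith
    have e3 : ε * ‖q‖ ≤ ρ / (2 * (B' + 1)) * B' :=
      mul_le_mul (min_le_right _ _) (hB' z hzD) (norm_nonneg _) (by positivity)
    have e4 : ρ / (2 * (B' + 1)) * B' ≤ ρ / 2 := by
      rw [div_mul_eq_mul_div, div_le_div_iff₀ (by positivity) (by norm_num)]
      nlinarith
    linarith

/-! ### The contradiction along a curve -/

/-- An analytic curve in `V` through `w` stays in the subspace where the dominant coordinates of
`w` are equal. -/
theorem eventually_collapse_eq_of_curve {n : ℕ} {V : Set (Fin n → ℂ)} (hVD : V ⊆ polydisc n)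
    (hdim : algDim V ≤ 1) (hext : PolynomialExtensionProperty (polydisc n) V)
    (h0 : (0 : Fin n → ℂ) ∈ V) {w : Fin n → ℂ} (hw : w ∈ V) {s : Finset (Fin n)} {i₀ : Fin n}
    (hi₀ : i₀ ∈ s) (hw_eq : ∀ l ∈ s, w l = w i₀) (hw_lt : ∀ l ∉ s, ‖w l‖ < ‖w i₀‖)
    (hw0 : w i₀ ≠ 0) {γ : ℂ → Fin n → ℂ} (hγ : AnalyticAt ℂ γ 0) (hγ0 : γ 0 = w)
    (hγV : ∀ᶠ τ in 𝓝 0, γ τ ∈ V) :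
    ∀ᶠ τ in 𝓝 0, γ τ - collapse s i₀ (γ τ) = 0 := by
  by_contra hcon
  set f : ℂ → Fin n → ℂ := fun τ ↦ γ τ - collapse s i₀ (γ τ) with hf
  have hfa : AnalyticAt ℂ f 0 :=
    hγ.sub (((collapse s i₀).analyticAt _).comp hγ)
  obtain ⟨m, g, hg, hg0, hfg⟩ := hfa.exists_eventuallyEq_pow_smul_nonzero_iff.2 hcon
  simp only [sub_zero] at hfg
  have hfl : ∀ τ l, f τ l = if l ∈ s then γ τ l - γ τ i₀ else 0 := fun τ l ↦ by
    simp only [hf, Pi.sub_apply, collapse_apply]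
    split_ifs <;> simp
  have hgl : ∀ l, (∀ τ, f τ l = 0) → g 0 l = 0 := by
    intro l hl
    have h1 : Tendsto (fun τ ↦ g τ l) (𝓝[≠] 0) (𝓝 (g 0 l)) :=
      (((continuous_apply l).tendsto _).comp hg.continuousAt).mono_left nhdsWithin_le_nhds
    have h2 : ∀ᶠ τ in 𝓝[≠] (0 : ℂ), g τ l = 0 := by
      filter_upwards [hfg.filter_mono nhdsWithin_le_nhds, self_mem_nhdsWithin] with τ hτ hτ0
      have := congrFun hτ l
      rw [hl, Pi.smul_apply, smul_eq_mul, eq_comm, mul_eq_zero] at this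
      exact this.resolve_left (pow_ne_zero _ hτ0)
    exact tendsto_nhds_unique_of_eventuallyEq h1 tendsto_const_nhds h2
  set v := g 0 with hv
  have hvi₀ : v i₀ = 0 := hgl i₀ fun τ ↦ by simp [hfl]
  have hvne : ∃ i ∈ s, ∃ j ∈ s, v i ≠ v j := by
    obtain ⟨l, hl⟩ := Function.ne_iff.1 hg0
    have hls : l ∈ s := by
      by_contra h
      exact hl (hgl l fun τ ↦ by simp [hfl, h])
    exact ⟨l, hls, i₀, hi₀, by rw [hvi₀]; exact hl⟩
  obtain ⟨i, hi, j, hj, hij, c, hc, hcij, hcle⟩ := exists_supporting_edge s v hvne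
  have hwD : w ∈ ball (0 : Fin n → ℂ) 1 := polydisc_eq_ball n ▸ hVD hw
  have hawD : ‖w i₀‖ < 1 := hVD hw i₀
  obtain ⟨σ, hσ, hpert⟩ := exists_perturbation_norm_le_one hVD hdim i j hawD
  -- Makes the perturbation contribute `ε * conj c` to `L v`, a shift along the outward normal of
  -- the edge.
  set κ := (starRingEnd ℂ) c / ((v i - v j) * σ.eval (w i₀)) with hκ
  obtain ⟨ε, hε, hle⟩ := hpert κ
  let P : MvPolynomial (Fin n) ℂ := MvPolynomial.C (1 / 2) * (MvPolynomial.X i + MvPolynomial.X j) +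
    MvPolynomial.C (ε * κ) * (MvPolynomial.X i - MvPolynomial.X j) *
      Polynomial.aeval (MvPolynomial.X i) σ
  have hP : ∀ z : Fin n → ℂ, MvPolynomial.eval z P =
      (z i + z j) / 2 + ε * κ * (z i - z j) * σ.eval (z i) := by
    intro z
    simp only [P, map_add, map_mul, map_sub, MvPolynomial.eval_C, MvPolynomial.eval_X,
      MvPolynomial.eval_polynomial_aeval]
    ring
  have hPle : ∀ z : V, ‖MvPolynomial.eval z.1 P‖ ≤ 1 := fun z ↦ by
    rw [hP]; exact hle z.1 z.2
  obtain ⟨F, hFd, hFb, hFP, hFsup⟩ := hext P ⟨1, by rintro _ ⟨z, rfl⟩; exact hPle z⟩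
  have : Nonempty V := ⟨⟨0, h0⟩⟩
  have hF1 : ∀ z ∈ ball (0 : Fin n → ℂ) 1, ‖F z‖ ≤ 1 := fun z hz ↦ by
    rw [← polydisc_eq_ball] at hz
    exact ((le_ciSup hFb ⟨z, hz⟩).trans_eq hFsup).trans (ciSup_le hPle)
  rw [polydisc_eq_ball] at hFd
  have hF0 : F 0 = 0 := by rw [hFP 0 h0, hP]; simp
  have hFw : F w = w i₀ := by rw [hFP w hw, hP, hw_eq i hi, hw_eq j hj]; ring
  have hnear : ∀ᶠ z in 𝓝 w, z ∈ ball (0 : Fin n → ℂ) 1 := isOpen_ball.mem_nhds hwD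
  have hFle : ∀ᶠ z in 𝓝 w, ‖F z‖ ≤ ‖z‖ := hnear.mono fun z hz ↦
    Complex.norm_le_norm_of_mapsTo_ball hFd (fun y hy ↦ by simpa using hF1 y hy) hF0
      (mem_ball_zero_iff.1 hz)
  have hFdw : ∀ᶠ z in 𝓝 w, DifferentiableAt ℂ F z := hnear.mono fun z hz ↦
    hFd.differentiableAt (isOpen_ball.mem_nhds hz)
  obtain ⟨r, hr, hrsub⟩ := Metric.isOpen_ball.mem_nhds hwD |> Metric.mem_nhds_iff.1
  -- Strictness is needed because `F` is compared at two moving points, `γ τ` and its collapse, with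
  -- an error measured by their difference, of order `τ ^ m`.
  have hstrict : HasStrictFDerivAt F (fderiv ℂ F w) w :=
    (hFd.mono hrsub).hasStrictFDerivAt_of_bounded_ball hr fun z hz ↦ hF1 z (hrsub hz)
  set L := fderiv ℂ F w with hL
  have hLle := re_mul_fderiv_le hstrict.hasFDerivAt hFle hFw hw_eq hw_lt hw0 c v _ hcle
  have hdiag := eventually_apply_collapse_eq hFdw hFle hFw hw_eq hw_lt hw0
  have hγc : Tendsto γ (𝓝 0) (𝓝 w) := hγ0 ▸ hγ.continuousAt.tendsto
  have hcw : collapse s i₀ w = w := by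
    ext l
    rw [collapse_apply]
    split_ifs with h
    · exact (hw_eq l h).symm
    · rfl
  have hγcc : Tendsto (fun τ ↦ collapse s i₀ (γ τ)) (𝓝 0) (𝓝 w) := by
    have := ((collapse s i₀).continuous.tendsto w).comp hγc
    rwa [hcw] at this
  set e : ℂ → ℂ := fun τ ↦ (g τ i + g τ j) / 2 +
    ε * κ * (g τ i - g τ j) * σ.eval (γ τ i) - L (g τ) with he
  -- `F` is known at `γ τ` by extension and at its collapse by `hdiag`; strict differentiability
  -- relates the difference of these values to `L`.
  have hlittle : (fun τ ↦ τ ^ m * e τ) =o[𝓝 0] fun τ ↦ τ ^ m := by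
    have h1 := (hstrict.isLittleO.comp_tendsto (hγc.prodMk_nhds hγcc))
    have h2 : (fun τ ↦ γ τ - collapse s i₀ (γ τ)) =O[𝓝 0] fun τ : ℂ ↦ τ ^ m := by
      have h3 : (fun τ : ℂ ↦ τ ^ m • g τ) =O[𝓝 0] fun τ : ℂ ↦ τ ^ m • (1 : ℂ) :=
        (isBigO_refl _ _).smul (hg.continuousAt.isBigO_one ℂ)
      refine (h3.congr' (hfg.mono fun τ hτ ↦ hτ.symm) (Eventually.of_forall fun τ ↦ ?_))
      simp
    refine (h1.trans_isBigO h2).congr' ?_ EventuallyEq.rfl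
    filter_upwards [hfg, hγV, hγc.eventually hdiag] with τ hτ hτV hτd
    have hfi := congrFun hτ i
    have hfj := congrFun hτ j
    rw [hfl, if_pos hi, Pi.smul_apply, smul_eq_mul] at hfi
    rw [hfl, if_pos hj, Pi.smul_apply, smul_eq_mul] at hfj
    have hLf : L (γ τ - collapse s i₀ (γ τ)) = τ ^ m * L (g τ) := by
      change L (f τ) = _
      rw [hτ, map_smul, smul_eq_mul]
    simp only [Function.comp]
    rw [hLf, hτd, hFP _ hτV, hP, he]
    linear_combination (1 / 2 + ε * κ * σ.eval (γ τ i)) * hfi +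
      (1 / 2 - ε * κ * σ.eval (γ τ i)) * hfj
  have he0 : e 0 = 0 := by
    have hec : Tendsto e (𝓝[≠] 0) (𝓝 (e 0)) := by
      have hgc := hg.continuousAt
      have hgi : ∀ l, ContinuousAt (fun τ ↦ g τ l) 0 := fun l ↦
        (continuous_apply l).continuousAt.comp hgc
      have hγi : ContinuousAt (fun τ ↦ σ.eval (γ τ i)) 0 :=
        σ.continuous.continuousAt.comp ((continuous_apply i).continuousAt.comp hγ.continuousAt)
      have hLg : ContinuousAt (fun τ ↦ L (g τ)) 0 := L.continuous.continuousAt.comp hgc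
      have : ContinuousAt e 0 :=
        ((((hgi i).add (hgi j)).div_const 2).add
          ((continuousAt_const.mul ((hgi i).sub (hgi j))).mul hγi)).sub hLg
      exact this.tendsto.mono_left nhdsWithin_le_nhds
    refine tendsto_nhds_unique hec ?_
    have h1 := (hlittle.mono (nhdsWithin_le_nhds (s := {0}ᶜ))).tendsto_div_nhds_zero
    refine h1.congr' ?_
    filter_upwards [self_mem_nhdsWithin] with τ hτ
    exact mul_div_cancel_left₀ _ (pow_ne_zero _ hτ)
  have hLv : c * L v = c * ((v i + v j) / 2) + ε * (c * (starRingEnd ℂ) c) := by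
    have h1 : (v i + v j) / 2 + ε * κ * (v i - v j) * σ.eval (w i₀) - L v = 0 := by
      have := he0
      simp only [he, hγ0, hw_eq i hi] at this
      exact this
    have h2 : κ * (v i - v j) * σ.eval (w i₀) = (starRingEnd ℂ) c := by
      rw [hκ, mul_assoc]
      exact div_mul_cancel₀ _ (mul_ne_zero (sub_ne_zero.2 hij) hσ)
    linear_combination (-c) * h1 + c * ε * h2
  have hre : (c * L v).re = (c * v i).re + ε * ‖c‖ ^ 2 := by
    have h1 : c * ((v i + v j) / 2) = ((1 / 2 : ℝ) : ℂ) * (c * v i + c * v j) := by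
      push_cast; ring
    rw [hLv, h1, Complex.mul_conj', Complex.add_re, Complex.re_ofReal_mul, Complex.add_re, hcij,
      ← Complex.ofReal_pow, Complex.re_ofReal_mul, Complex.ofReal_re]
    ring
  have : 0 < ε * ‖c‖ ^ 2 := by positivity
  linarith

/-! ### Regular points and the identity theorem -/

/-- Any two points of `V` close to a regular point lie on an analytic disc contained in `V`. -/
theorem IsRegularPoint.exists_nhds_disc {n : ℕ} {V : Set (Fin n → ℂ)} {a : Fin n → ℂ}
    (ha : IsRegularPoint V a) : ∃ N ∈ 𝓝 a, ∀ x ∈ N ∩ V, ∀ y ∈ N ∩ V,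
      ∃ γ : ℂ → Fin n → ℂ, ∃ R : ℝ, 1 < R ∧ DifferentiableOn ℂ γ (ball 0 R) ∧ γ 0 = x ∧ γ 1 = y ∧
        ∀ τ ∈ ball (0 : ℂ) R, γ τ ∈ V := by
  obtain ⟨-, d, -, Φ, haΦ, -, hΦs, hΦV⟩ := ha
  obtain ⟨r, hr, hrsub⟩ := Metric.mem_nhds_iff.1 (Φ.open_target.mem_nhds (Φ.map_source haΦ))
  refine ⟨Φ.source ∩ Φ ⁻¹' ball (Φ a) (r / 4), inter_mem (Φ.open_source.mem_nhds haΦ)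
    ((Φ.continuousAt haΦ).preimage_mem_nhds (ball_mem_nhds _ (by positivity))), ?_⟩
  rintro x ⟨⟨hxs, hxb⟩, hxV⟩ y ⟨⟨hys, hyb⟩, hyV⟩
  rw [mem_preimage, mem_ball, dist_eq_norm] at hxb hyb
  -- The radius `5 / 4` puts `τ = 1` inside the disc, while `r / 4 + 5 / 4 * (r / 2) < r` keeps the
  -- segment's complex extension in the target.
  have hmem : ∀ τ ∈ ball (0 : ℂ) (5 / 4), Φ x + τ • (Φ y - Φ x) ∈ Φ.target := by
    intro τ hτ
    rw [mem_ball_zero_iff] at hτ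
    refine hrsub ?_
    rw [mem_ball, dist_eq_norm]
    have h1 : ‖Φ y - Φ x‖ ≤ r / 2 := by
      have := norm_sub_le (Φ y - Φ a) (Φ x - Φ a)
      rw [sub_sub_sub_cancel_right] at this
      linarith
    calc ‖Φ x + τ • (Φ y - Φ x) - Φ a‖ = ‖(Φ x - Φ a) + τ • (Φ y - Φ x)‖ := by congr 1; abel
      _ ≤ ‖Φ x - Φ a‖ + ‖τ‖ * ‖Φ y - Φ x‖ := (norm_add_le _ _).trans_eq (by rw [norm_smul])
      _ ≤ ‖Φ x - Φ a‖ + 5 / 4 * (r / 2) := by gcongr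
      _ < r := by linarith
  refine ⟨fun τ ↦ Φ.symm (Φ x + τ • (Φ y - Φ x)), 5 / 4, by norm_num, ?_, ?_, ?_, ?_⟩
  · exact hΦs.comp (by fun_prop) hmem
  · simp [Φ.left_inv hxs]
  · simp [Φ.left_inv hys]
  · intro τ hτ
    refine (hΦV _ (Φ.map_target (hmem τ hτ))).2 fun i hi ↦ ?_
    rw [Φ.right_inv (hmem τ hτ)]
    simp [(hΦV x hxs).1 hxV i hi, (hΦV y hys).1 hyV i hi]

/-- Identity theorem on the regular part of an analytic set: if a continuous linear map vanishes on
`V` near one regular point, then it vanishes on the irreducible component through that point. -/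
theorem IsIrreducibleComponent.eq_zero_of_eventually {n : ℕ} {V S : Set (Fin n → ℂ)}
    (hS : IsIrreducibleComponent V S) {w : Fin n → ℂ} (hwS : w ∈ S) {E : Type*}
    [NormedAddCommGroup E] [NormedSpace ℂ E] [CompleteSpace E] (δ : (Fin n → ℂ) →L[ℂ] E)
    (hδ : ∀ᶠ z in 𝓝 w, z ∈ V → δ z = 0) {z : Fin n → ℂ} (hz : z ∈ S) : δ z = 0 := by
  obtain ⟨a, -, rfl⟩ := hS
  set C := connectedComponentIn {z | IsRegularPoint V z} a with hC
  have hCreg : C ⊆ {z | IsRegularPoint V z} := connectedComponentIn_subset _ _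
  set u : Set (Fin n → ℂ) := {b | ∀ᶠ z in 𝓝 b, z ∈ V → δ z = 0} with hu
  -- Discs show that a neighbourhood of a regular point either has no point of `V` in `u` or has `δ
  -- = 0` on all of its part of `V`. So `u` and `u'` split the connected set `C`.
  set u' : Set (Fin n → ℂ) := {b | ∀ᶠ z in 𝓝 b, z ∈ V → z ∉ u} with hu'
  have huo : IsOpen u := isOpen_setOfPred_eventually_nhds
  have huo' : IsOpen u' := isOpen_setOfPred_eventually_nhds
  have hcover : C ⊆ u ∪ u' := by
    intro b hb
    by_contra hcon
    simp only [mem_union, not_or] at hcon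
    obtain ⟨N, hN, hdisc⟩ := (hCreg hb).exists_nhds_disc
    refine hcon.2 ?_
    filter_upwards [hN] with x hxN hxV hxu
    refine hcon.1 ?_
    filter_upwards [hN] with y hyN hyV
    obtain ⟨γ, R, hR, hγd, hγ0, hγ1, hγV⟩ := hdisc x ⟨hxN, hxV⟩ y ⟨hyN, hyV⟩
    have hR0 : (0 : ℂ) ∈ ball (0 : ℂ) R := mem_ball_self (by linarith)
    have han : AnalyticOnNhd ℂ (fun τ ↦ δ (γ τ)) (ball 0 R) :=
      (δ.differentiable.comp_differentiableOn hγd).analyticOnNhd isOpen_ball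
    have hγc : Tendsto γ (𝓝 0) (𝓝 x) := by
      have := (hγd.continuousOn.continuousAt (isOpen_ball.mem_nhds hR0)).tendsto
      rwa [hγ0] at this
    have hzero : (fun τ ↦ δ (γ τ)) =ᶠ[𝓝 0] 0 := by
      filter_upwards [hγc.eventually hxu, isOpen_ball.mem_nhds hR0] with τ hτ hτR
      exact hτ (hγV τ hτR)
    have h1 := han.eqOn_zero_of_preconnected_of_eventuallyEq_zero
      (convex_ball _ _).isPreconnected hR0 hzero (show (1 : ℂ) ∈ ball (0 : ℂ) R by simpa using hR)
    simpa [hγ1] using h1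
  have hdisj : C ∩ (u ∩ u') = ∅ := by
    ext b
    simp only [mem_inter_iff, mem_empty_iff_false, iff_false, not_and]
    intro hb hbu hbu'
    exact hbu'.self_of_nhds (hCreg hb).1 hbu
  -- `w` is only known to lie in the closure of `C`, but `u` is an open neighbourhood of `w` and so
  -- meets `C`.
  obtain ⟨x, hxu, hxC⟩ := mem_closure_iff.1 hwS.1 u huo hδ
  have hCu : C ⊆ u := by
    refine (isPreconnected_iff_subset_of_disjoint.1 isPreconnected_connectedComponentIn u u' huo
      huo' hcover hdisj).resolve_right fun h ↦ ?_
    have : x ∈ C ∩ (u ∩ u') := ⟨hxC, hxu, h hxC⟩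
    rwa [hdisj] at this
  have hclosed : IsClosed {z | δ z = 0} := isClosed_eq δ.continuous continuous_const
  exact closure_minimal (fun x hx ↦ (hCu hx).self_of_nhds (hCreg hx).1) hclosed hz.1

theorem lemma12 (n k : ℕ) (hk : 2 ≤ k) (hkn : k < n)
    (V : Set (Fin n → ℂ)) (hV : IsAlgebraicIn V) (hdim : algDim V = 1)
    (hext : PolynomialExtensionProperty (polydisc n) V)
    (h0 : (0 : Fin n → ℂ) ∈ V)
    (w : Fin n → ℂ) (hw : IsRegularPoint V w)
    (hw_eq : ∀ i j : Fin n, i.val < k → j.val < k → w i = w j)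
    (hw_lt : ∀ i j : Fin n, i.val < k → k ≤ j.val → ‖w j‖ < ‖w i‖)
    (S : Set (Fin n → ℂ)) (hS : IsIrreducibleComponent V S) (hwS : w ∈ S) :
    S ⊆ {z | ∀ i j : Fin n, i.val < k → j.val < k → z i = z j} := by
  have hVD : V ⊆ polydisc n := by
    obtain ⟨P, rfl⟩ := hV
    exact fun z hz ↦ hz.1
  let i₀ : Fin n := ⟨0, by omega⟩
  let s : Finset (Fin n) := Finset.univ.filter fun i ↦ i.val < k
  have hs : ∀ i, i ∈ s ↔ i.val < k := fun i ↦ by simp [s]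
  have hi₀ : i₀ ∈ s := (hs i₀).2 (by simp only [i₀]; omega)
  have hw_eq' : ∀ l ∈ s, w l = w i₀ := fun l hl ↦ hw_eq l i₀ ((hs l).1 hl) ((hs i₀).1 hi₀)
  have hw_lt' : ∀ l ∉ s, ‖w l‖ < ‖w i₀‖ := fun l hl ↦
    hw_lt i₀ l ((hs i₀).1 hi₀) (by rw [hs] at hl; omega)
  -- Since `k < n`, some coordinate is strictly dominated by `w i₀`.
  have hw0 : w i₀ ≠ 0 := norm_pos_iff.1
    ((norm_nonneg _).trans_lt (hw_lt i₀ ⟨k, hkn⟩ ((hs i₀).1 hi₀) le_rfl))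
  set δ : (Fin n → ℂ) →L[ℂ] (Fin n → ℂ) := ContinuousLinearMap.id ℂ _ - collapse s i₀ with hδ
  have hlocal : ∀ᶠ z in 𝓝 w, z ∈ V → δ z = 0 := by
    obtain ⟨N, hN, hdisc⟩ := hw.exists_nhds_disc
    filter_upwards [hN] with y hyN hyV
    obtain ⟨γ, R, hR, hγd, hγ0, hγ1, hγV⟩ := hdisc w ⟨mem_of_mem_nhds hN, hw.1⟩ y ⟨hyN, hyV⟩
    have hR0 : (0 : ℂ) ∈ ball (0 : ℂ) R := mem_ball_self (by linarith)
    have hnhds := isOpen_ball.mem_nhds hR0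
    have hev := eventually_collapse_eq_of_curve hVD hdim.le hext h0 hw.1 hi₀ hw_eq' hw_lt' hw0
      (hγd.analyticAt hnhds) hγ0 (mem_of_superset hnhds hγV)
    have han : AnalyticOnNhd ℂ (fun τ ↦ δ (γ τ)) (ball 0 R) :=
      (δ.differentiable.comp_differentiableOn hγd).analyticOnNhd isOpen_ball
    have h1 := han.eqOn_zero_of_preconnected_of_eventuallyEq_zero
      (convex_ball _ _).isPreconnected hR0 hev (show (1 : ℂ) ∈ ball (0 : ℂ) R by simpa using hR)
    simpa [hγ1] using h1
  intro z hz
  have hzδ := hS.eq_zero_of_eventually hwS δ hlocal hz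
  have hzl : ∀ l ∈ s, z l = z i₀ := fun l hl ↦ by
    have := congrFun hzδ l
    simp only [hδ, sub_apply, ContinuousLinearMap.id_apply, Pi.sub_apply,
      collapse_apply, if_pos hl, Pi.zero_apply] at this
    exact sub_eq_zero.1 this
  intro i j hi hj
  rw [hzl i ((hs i).2 hi), hzl j ((hs j).2 hj)]
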